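/- All graphs are finite and simple. A graph is called $2$-connected if it has at least three vertices, is connected, and remains connected after the deletion of any single vertex. A graph $G$ is called cummerbund covered if every vertex of $G$ lies on some longest cycle of $G$. Let $\delta(G)$ denote the minimum degree of $G$. Theorem. If $G$ is a $2$-connected graph of order $n$ with $\delta(G)\ge n/3$, then $G$ is cummerbund covered. The bound $n/3$ is best possible: for every integer $n\ge 9$ there exists a $2$-connected graph $H_n$ of order $n$ with $\delta(H_n)=\lceil n/3\rceil-1$ which is not cummerbund covered. -/

import Mathlib

namespace SimpleGraph

variable {V : Type*}

/-- A finite graph is `k`-connected if it has more than `k` vertices and it remains connected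
whenever fewer than `k` vertices are deleted. -/
def IsKConnected [Fintype V] (G : SimpleGraph V) (k : ℕ) : Prop :=
  k < Fintype.card V ∧
    ∀ S : Finset V, S.card < k → (G.induce {v : V | v ∉ S}).Connected

/-- A cummerbund is a longest cycle of the graph. -/
def Walk.IsCummerbund {G : SimpleGraph V} {u : V} (c : G.Walk u u) : Prop :=
  c.IsCycle ∧ ∀ (w : V) (d : G.Walk w w), d.IsCycle → d.length ≤ c.length

/-- A graph is cummerbund covered if every vertex lies in a cummerbund. -/
def IsCummerbundCovered (G : SimpleGraph V) : Prop :=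
  ∀ v : V, ∃ (u : V) (c : G.Walk u u), c.IsCummerbund ∧ v ∈ c.support

end SimpleGraph

/-! Suppose `v` lies on no longest cycle. Fix a longest cycle C of length c, and let every degree be
at least d. A path that leaves C and returns to it can replace an arc of C between its ends, so it
is no longer than either arc, and strictly shorter if it contains `v` (`PathOn.card_le_of_longest`).
Hence, if a path off C through `v` has p vertices, distinct neighbours on C of its two ends are at
least p + 2 steps apart. `ZMod.exists_gap_count` adds up such gaps around C.

This gives c ≥ 2d + 2 (`IsKConnected.two_mul_add_two_le`). Take a largest path that starts on C,
contains `v`, is otherwise off C and ends at w. All neighbours of w are on the path or on C. If w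
has a neighbour on C other than the start, count gaps. Otherwise 2-connectivity reroutes the path
into one between two points of C that contains all neighbours of w off C
(`PathOn.exists_covering_neighbors`), and both arcs between these points are at least as long.

If n ≤ 3d, at most d - 2 vertices are then off C, so each of them has several neighbours on C.
Counting gaps for the ends of a largest path off C starting at `v` contradicts n ≤ 3d.

For sharpness, join two hub vertices to three disjoint cliques. A cycle meets at most two of the
cliques, so the longest cycles avoid a clique that is strictly smallest. -/

namespace SimpleGraph

/-! ### Paths and cycles recorded by their vertex sets. -/

/-- `PathOn G a b T`: the graph `G` has a path from `a` to `b` whose vertex set is exactly `T`. -/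
inductive PathOn {V : Type*} [DecidableEq V] (G : SimpleGraph V) : V → V → Finset V → Prop
  | single (a : V) : PathOn G a a {a}
  | cons {a b c : V} {T : Finset V} (hab : G.Adj a b) (ha : a ∉ T) (h : PathOn G b c T) :
      PathOn G a c (insert a T)

namespace PathOn

variable {V : Type*} [DecidableEq V] {G : SimpleGraph V} {a b c d x : V} {T T' : Finset V}

lemma left_mem (h : PathOn G a b T) : a ∈ T := by
  cases h <;> simp

lemma right_mem (h : PathOn G a b T) : b ∈ T := by
  induction h with
  | single a => simp
  | cons _ _ _ ih => simp [ih]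

/-- Concatenation along an edge. -/
lemma join (h : PathOn G a b T) (hbc : G.Adj b c) (h' : PathOn G c d T') (hd : Disjoint T T') :
    PathOn G a d (T ∪ T') := by
  induction h with
  | single a =>
    simp only [Finset.disjoint_singleton_left] at hd
    exact .cons hbc hd h'
  | @cons a x b T hax ha h ih =>
    rw [Finset.disjoint_insert_left] at hd
    rw [Finset.insert_union]
    exact .cons hax (by simp [ha, hd.1]) (ih hbc hd.2)

lemma symm (h : PathOn G a b T) : PathOn G b a T := by
  induction h with
  | single a => exact .single a
  | @cons a x b T hax ha h ih =>
    have := ih.join hax.symm (.single a) (by simpa using ha)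
    rwa [Finset.union_comm] at this

lemma concat (h : PathOn G a b T) (hbc : G.Adj b c) (hc : c ∉ T) : PathOn G a c (insert c T) :=
  (PathOn.cons hbc.symm hc h.symm).symm

/-- Concatenation at a common end. -/
lemma append (h : PathOn G a b T) (h' : PathOn G b c T')
    (hd : ∀ x ∈ T, x ∈ T' → x = b) : PathOn G a c (T ∪ T') := by
  induction h with
  | single a =>
    rwa [Finset.union_eq_right.2]
    simpa using h'.left_mem
  | @cons a x b T hax ha h ih =>
    rw [Finset.insert_union]
    refine .cons hax ?_ (ih h' fun y hy => hd y (by simp [hy]))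
    rw [Finset.mem_union, not_or]
    refine ⟨ha, fun h1 => ha ?_⟩
    rw [hd a (by simp) h1]
    exact h.right_mem

/-- Splitting a path at its first vertex with a given property. -/
lemma first_hit (h : PathOn G a b T) (P : V → Prop) (hP : ∃ t ∈ T, P t) :
    ∃ t T₁ T₂, PathOn G a t T₁ ∧ PathOn G t b T₂ ∧ T = T₁ ∪ T₂ ∧ (∀ x ∈ T₁, x ∈ T₂ → x = t) ∧
      P t ∧ ∀ x ∈ T₁, P x → x = t := by
  induction h with
  | single a =>
    refine ⟨a, {a}, {a}, .single a, .single a, by simp, by simp, by simpa using hP, by simp⟩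
  | @cons a y b T hay ha h ih =>
    by_cases hPa : P a
    · exact ⟨a, {a}, insert a T, .single a, .cons hay ha h, by simp, by simp, hPa, by simp⟩
    · obtain ⟨t, T₁, T₂, h1, h2, rfl, h4, h5, h6⟩ := ih (by
        obtain ⟨t, ht, hPt⟩ := hP
        rcases Finset.mem_insert.1 ht with rfl | ht
        · exact absurd hPt hPa
        · exact ⟨t, ht, hPt⟩)
      simp only [Finset.mem_union, not_or] at ha
      refine ⟨t, insert a T₁, T₂, .cons hay ha.1 h1, h2, by rw [Finset.insert_union], ?_, h5, ?_⟩
      · intro x hx hx2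
        rcases Finset.mem_insert.1 hx with rfl | hx
        · exact absurd hx2 ha.2
        · exact h4 x hx hx2
      · intro x hx hx2
        rcases Finset.mem_insert.1 hx with rfl | hx
        · exact absurd hx2 hPa
        · exact h6 x hx hx2

/-- Splitting a path at one of its vertices. -/
lemma split (h : PathOn G a b T) (hx : x ∈ T) :
    ∃ T₁ T₂, PathOn G a x T₁ ∧ PathOn G x b T₂ ∧ T = T₁ ∪ T₂ ∧ ∀ y ∈ T₁, y ∈ T₂ → y = x := by
  obtain ⟨t, T₁, T₂, h1, h2, h3, h4, h5, -⟩ := h.first_hit (· = x) ⟨x, hx, rfl⟩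
  subst h5
  exact ⟨T₁, T₂, h1, h2, h3, h4⟩

/-- A path between distinct vertices begins with an edge. -/
lemma exists_tail (h : PathOn G a b T) (hab : a ≠ b) :
    ∃ y, G.Adj a y ∧ PathOn G y b (T.erase a) := by
  cases h with
  | single => exact absurd rfl hab
  | cons hay ha h => exact ⟨_, hay, by rwa [Finset.erase_insert ha]⟩

lemma exists_walk (h : PathOn G a b T) :
    ∃ p : G.Walk a b, p.IsPath ∧ p.length + 1 = T.card ∧ ∀ x, x ∈ p.support ↔ x ∈ T := by
  induction h with
  | single a => exact ⟨.nil, by simp, by simp, by simp⟩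
  | cons hab ha h ih =>
    obtain ⟨p, hp, hl, hs⟩ := ih
    refine ⟨.cons hab p, ?_, ?_, ?_⟩
    · rw [Walk.cons_isPath_iff]
      exact ⟨hp, by rwa [hs]⟩
    · rw [Finset.card_insert_of_notMem ha, Walk.length_cons, hl]
    · intro x
      simp [hs]

lemma of_walk {p : G.Walk a b} (hp : p.IsPath) : PathOn G a b p.support.toFinset := by
  induction p with
  | nil => simpa using PathOn.single _
  | cons hab p ih =>
    rw [Walk.cons_isPath_iff] at hp
    simpa using PathOn.cons hab (by simpa using hp.2) (ih hp.1)

lemma exists_of_clique {S : Finset V} (hS : ∀ x ∈ S, ∀ y ∈ S, x ≠ y → G.Adj x y)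
    (ha : a ∈ S) (hb : b ∈ S) (hab : a ≠ b) : PathOn G a b S := by
  induction hn : S.card generalizing S a with
  | zero => simp_all
  | succ n ih =>
    by_cases hx : ∃ x ∈ S, x ≠ a ∧ x ≠ b
    · obtain ⟨x, hxS, hxa, hxb⟩ := hx
      have := ih (S := S.erase a) (a := x)
        (fun u hu w hw => hS u (Finset.mem_of_mem_erase hu) w (Finset.mem_of_mem_erase hw))
        (by simp [hxS, hxa]) (by simp [hb, hab.symm]) hxb
        (by rw [Finset.card_erase_of_mem ha]; omega)
      have h2 := PathOn.cons (hS a ha x hxS hxa.symm) (by simp) this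
      rwa [Finset.insert_erase ha] at h2
    · push Not at hx
      have : S = insert a {b} := by
        ext y
        simp only [Finset.mem_insert, Finset.mem_singleton]
        constructor
        · intro hy
          by_contra! h
          exact h.2 (hx y hy h.1)
        · rintro (rfl | rfl) <;> assumption
      rw [this]
      exact .cons (hS a ha b hb hab) (by simpa using hab) (.single b)

end PathOn

section Cycle

variable {V : Type*} [DecidableEq V] {G : SimpleGraph V}

/-- `G` has a cycle whose vertex set is exactly `U`. -/
def CycleOn (G : SimpleGraph V) (U : Finset V) : Prop :=
  3 ≤ U.card ∧ ∃ a b, PathOn G a b U ∧ G.Adj b a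

/-- The bound `h3` excludes one edge traversed twice. -/
lemma PathOn.cycleOn_union {x y : V} {T U : Finset V} (hT : PathOn G x y T) (hU : PathOn G y x U)
    (hxy : x ≠ y) (h : ∀ z ∈ T, z ∈ U → z = x ∨ z = y) (h3 : 3 ≤ (T ∪ U).card) :
    CycleOn G (T ∪ U) := by
  obtain ⟨x', hx', hT'⟩ := hT.exists_tail hxy
  have := hT'.append hU (fun z hz hzU => by
    rw [Finset.mem_erase] at hz
    exact (h z hz.2 hzU).resolve_left hz.1)
  have he : T.erase x ∪ U = T ∪ U := by
    ext z
    simp only [Finset.mem_union, Finset.mem_erase]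
    have := hU.right_mem
    grind
  rw [he] at this
  exact ⟨h3, _, _, this, hx'⟩

lemma CycleOn.exists_paths {U : Finset V} (h : CycleOn G U) {p q : V} (hp : p ∈ U) (hq : q ∈ U)
    (hpq : p ≠ q) : ∃ T₁ T₂, PathOn G p q T₁ ∧ PathOn G p q T₂ ∧ U = T₁ ∪ T₂ ∧
      ∀ z ∈ T₁, z ∈ T₂ → z = p ∨ z = q := by
  obtain ⟨-, x, y, hU, hyx⟩ := h
  -- The cycle is cut open at the edge `hyx`. With `q` after `p`, one arc runs directly from `p` to
  -- `q` and the other uses the closing edge. Reversal handles the other order.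
  have key : ∀ x y, PathOn G x y U → G.Adj y x → ∀ T₁ T₂, PathOn G x p T₁ → PathOn G p y T₂ →
      U = T₁ ∪ T₂ → (∀ z ∈ T₁, z ∈ T₂ → z = p) → q ∈ T₂ →
      ∃ T₁ T₂, PathOn G p q T₁ ∧ PathOn G p q T₂ ∧ U = T₁ ∪ T₂ ∧
      ∀ z ∈ T₁, z ∈ T₂ → z = p ∨ z = q := by
    intro x y hU hyx T₁ T₂ h1 h2 h12 hd hq
    obtain ⟨T₃, T₄, h3, h4, rfl, hd'⟩ := h2.split hq
    have hpT := h3.left_mem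
    refine ⟨T₃, T₁ ∪ T₄, h3, h1.symm.join hyx.symm h4.symm ?_, ?_, ?_⟩
    · rw [Finset.disjoint_left]
      intro z hz1 hz4
      have := hd z hz1 (by simp [hz4])
      subst this
      exact hpq (hd' z hpT hz4)
    · rw [h12]
      ext z; simp only [Finset.mem_union]; tauto
    · intro z hz hz'
      rcases Finset.mem_union.1 hz' with h | h
      · exact .inl (hd z h (by simp [hz]))
      · exact .inr (hd' z hz h)
  obtain ⟨T₁, T₂, h1, h2, h12, hd⟩ := hU.split hp
  have hq' := hq
  rw [h12, Finset.mem_union] at hq'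
  rcases hq' with hq' | hq'
  · exact key y x hU.symm hyx.symm T₂ T₁ h2.symm h1.symm (by rw [h12, Finset.union_comm])
      (fun z hz hz' => hd z hz' hz) hq'
  · exact key x y hU hyx T₁ T₂ h1 h2 h12 hd hq'

lemma CycleOn.exists_walk {U : Finset V} (h : CycleOn G U) :
    ∃ (u : V) (c : G.Walk u u), c.IsCycle ∧ c.length = U.card ∧ ∀ x, x ∈ c.support ↔ x ∈ U := by
  obtain ⟨h3, a, b, hU, hba⟩ := h
  obtain ⟨p, hp, hl, hs⟩ := hU.exists_walk
  refine ⟨b, .cons hba p, ?_, by simp [hl], ?_⟩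
  · rw [Walk.cons_isCycle_iff]
    refine ⟨hp, fun he => ?_⟩
    have := hp.length_eq_one_of_mem_edges (Sym2.eq_swap ▸ he)
    omega
  · intro x
    simp only [Walk.support_cons, List.mem_cons, hs]
    constructor
    · rintro (rfl | h)
      · exact hU.right_mem
      · exact h
    · exact .inr

lemma Walk.IsCycle.cycleOn {u : V} {c : G.Walk u u} (hc : c.IsCycle) :
    CycleOn G c.support.toFinset ∧ c.support.toFinset.card = c.length := by
  cases c with
  | nil => simp at hc
  | @cons _ w _ h p =>
    have h3 := hc.three_le_length
    rw [Walk.cons_isCycle_iff] at hc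
    have hpo := PathOn.of_walk hc.1
    have he : (Walk.cons h p).support.toFinset = p.support.toFinset := by
      simp
    have hcard : p.support.toFinset.card = p.length + 1 := by
      rw [List.toFinset_card_of_nodup hc.1.support_nodup, Walk.length_support]
    rw [Walk.length_cons] at h3 ⊢
    rw [he]
    exact ⟨⟨by omega, _, _, hpo, h⟩, hcard⟩

/-- Longest cycles through a given vertex, in terms of vertex sets. -/
lemma exists_isCummerbund_iff (v : V) :
    (∃ (u : V) (c : G.Walk u u), c.IsCummerbund ∧ v ∈ c.support) ↔
      ∃ U, CycleOn G U ∧ (∀ U', CycleOn G U' → U'.card ≤ U.card) ∧ v ∈ U := by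
  constructor
  · rintro ⟨u, c, ⟨hc, hmax⟩, hv⟩
    refine ⟨_, hc.cycleOn.1, fun U' hU' => ?_, by simpa using hv⟩
    obtain ⟨w, d, hd, hl, -⟩ := hU'.exists_walk
    rw [hc.cycleOn.2, ← hl]
    exact hmax w d hd
  · rintro ⟨U, hU, hmax, hv⟩
    obtain ⟨w, d, hd, hl, hs⟩ := hU.exists_walk
    refine ⟨w, d, ⟨hd, fun w' d' hd' => ?_⟩, (hs v).2 hv⟩
    rw [hl, ← hd'.cycleOn.2]
    exact hmax _ hd'.cycleOn.1

end Cycle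

/-- In a 2-connected graph any two vertices are joined by a path avoiding a third one. -/
lemma IsKConnected.exists_pathOn {V : Type*} [DecidableEq V] [Fintype V] {G : SimpleGraph V}
    (h : G.IsKConnected 2) {u a b : V} (ha : a ≠ u) (hb : b ≠ u) :
    ∃ T, PathOn G a b T ∧ u ∉ T := by
  have hc := h.2 {u} (by simp)
  obtain ⟨p⟩ := hc.preconnected ⟨a, by simpa using ha⟩ ⟨b, by simpa using hb⟩
  let f : G.induce {v : V | v ∉ ({u} : Finset V)} →g G :=
    ⟨Subtype.val, fun h => h⟩
  refine ⟨_, PathOn.of_walk ((p.map f).bypass_isPath), ?_⟩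
  intro hu
  have := (p.map f).support_bypass_subset_support (by simpa using hu)
  rw [Walk.support_map, List.mem_map] at this
  obtain ⟨x, -, hx⟩ := this
  exact x.2 (Finset.mem_singleton.2 hx)

end SimpleGraph

/-! ### Counting gaps around a cycle. -/

/-- Blocks of consecutive residues starting at the elements of `M` and otherwise avoiding `M`
are disjoint. -/
lemma ZMod.sum_gaps_le {c : ℕ} [NeZero c] (M : Finset (ZMod c)) (w : ZMod c → ℕ)
    (hw : ∀ i ∈ M, ∀ k : ℕ, 0 < k → k < w i → i + k ∉ M) : ∑ i ∈ M, w i ≤ c := by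
  have h : (M.sigma fun i => Finset.range (w i)).card ≤ (Finset.univ : Finset (ZMod c)).card := by
    refine Finset.card_le_card_of_injOn (fun x => x.1 + (x.2 : ZMod c)) (by simp) ?_
    -- A common point places `i` in the block of `j` at offset `l - k`, which `hw` forces to be
    -- zero.
    have key : ∀ i ∈ M, ∀ j ∈ M, ∀ k l : ℕ, l < w j → k ≤ l → i + (k : ZMod c) = j + l →
        i = j ∧ k = l := by
      intro i hi j hj k l hl hkl he
      have hij : i = j + ((l - k : ℕ) : ZMod c) := by
        rw [Nat.cast_sub hkl]
        linear_combination he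
      rcases Nat.eq_zero_or_pos (l - k) with h0 | h0
      · rw [h0] at hij
        exact ⟨by simpa using hij, by omega⟩
      · exact absurd (hij ▸ hi) (hw j hj _ h0 (by omega))
    rintro ⟨i, k⟩ hik ⟨j, l⟩ hjl he
    simp only [Finset.coe_sigma, Set.mem_sigma_iff, Finset.mem_coe, Finset.mem_range] at hik hjl
    simp only at he
    rcases le_total k l with hkl | hkl
    · obtain ⟨rfl, rfl⟩ := key i hik.1 j hjl.1 k l hjl.2 hkl he
      rfl
    · obtain ⟨rfl, rfl⟩ := key j hjl.1 i hik.1 l k hik.2 hkl he.symm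
      rfl
  simpa [Finset.card_sigma, ZMod.card] using h

/-- Some element of `A` has its cyclic successor within `A ∪ B` in `B`. -/
lemma ZMod.exists_closest {c : ℕ} [NeZero c] (A B : Finset (ZMod c))
    (hAB : ∃ a ∈ A, ∃ b ∈ B, a ≠ b) :
    ∃ i ∈ A, ∃ k : ℕ, 0 < k ∧ k < c ∧ i + k ∈ B ∧
      ∀ l : ℕ, 0 < l → l < k → i + l ∉ A ∧ i + l ∉ B := by
  classical
  -- Take the least distance over all pairs: an element of `A` or `B` strictly in between would give
  -- a closer pair.
  have hex : ∃ k : ℕ, 0 < k ∧ k < c ∧ ∃ i ∈ A, i + (k : ZMod c) ∈ B := by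
    obtain ⟨a, ha, b, hb, hab⟩ := hAB
    refine ⟨(b - a).val, ?_, ZMod.val_lt _, a, ha, by simpa using hb⟩
    rw [Nat.pos_iff_ne_zero, Ne, ZMod.val_eq_zero, sub_eq_zero]
    exact hab.symm
  obtain ⟨h0, hc, i, hi, hik⟩ := Nat.find_spec hex
  refine ⟨i, hi, Nat.find hex, h0, hc, hik, fun l hl hlk => ⟨fun h => ?_, fun h => ?_⟩⟩
  · refine Nat.find_min hex (m := Nat.find hex - l) (by omega)
      ⟨by omega, by omega, i + l, h, ?_⟩
    rw [Nat.cast_sub hlk.le]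
    convert hik using 1
    ring
  · exact Nat.find_min hex hlk ⟨hl, by omega, i, hi, h⟩

/-- Counting lemma: `A` and `B` are sets of positions on a cycle of length `c`, with at least `2`
steps between different positions, and at least `p + 2` steps between a position in `A` and another
in `B`. -/
lemma ZMod.exists_gap_count {c : ℕ} [NeZero c] (A B : Finset (ZMod c)) (p : ℕ)
    (hA : A.Nonempty) (hB : B.Nonempty) (hcard : 2 ≤ (A ∪ B).card)
    (h2 : ∀ i ∈ A ∪ B, ∀ k : ℕ, 0 < k → k < c → i + k ∈ A ∪ B → 2 ≤ k)
    (hAB : ∀ i ∈ A, ∀ k : ℕ, 0 < k → k < c → i + k ∈ B → p + 2 ≤ k)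
    (hBA : ∀ i ∈ B, ∀ k : ℕ, 0 < k → k < c → i + k ∈ A → p + 2 ≤ k) :
    ∃ g α β : ℕ, 2 ≤ g ∧ A.card ≤ g + α ∧ B.card ≤ g + β ∧
      g * (p + 2) + 2 * α + 2 * β ≤ c := by
  classical
  set M := A ∪ B with hM
  have hnext : ∀ i, ∃ k : ℕ, i ∈ M → 0 < k ∧ k < c ∧ i + k ∈ M ∧
      ∀ l : ℕ, 0 < l → l < k → i + l ∉ M := by
    intro i
    by_cases hi : i ∈ M
    · obtain ⟨j, hj, hji⟩ := Finset.exists_mem_ne (by omega : 1 < M.card) i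
      obtain ⟨i', hi', k, h0, hk, hik, hl⟩ := ZMod.exists_closest {i} M
        ⟨i, by simp, j, hj, hji.symm⟩
      rw [Finset.mem_singleton] at hi'
      subst hi'
      exact ⟨k, fun _ => ⟨h0, hk, hik, fun l h1 h2 => (hl l h1 h2).2⟩⟩
    · exact ⟨0, fun h => absurd h hi⟩
  choose w hw using hnext
  have hsum := ZMod.sum_gaps_le M w fun i hi k h0 hk => (hw i hi).2.2.2 k h0 hk
  have hwu : ∀ i ∈ M, ∀ k : ℕ, 0 < k → i + k ∈ M → (∀ l : ℕ, 0 < l → l < k → i + l ∉ M) →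
      k = w i := by
    intro i hi k h0 hik hl
    obtain ⟨h1, -, h2, h3⟩ := hw i hi
    rcases lt_trichotomy k (w i) with h | h | h
    · exact absurd hik (h3 k h0 h)
    · exact h
    · exact absurd h2 (hl _ h1 h)
  -- Gaps after good positions have length at least `p + 2`, all others at least 2. A position in
  -- both sets is good (`hbad`), so the remaining ones split disjointly into the `α` and `β` counted
  -- below.
  let good : ZMod c → Prop := fun i => (i ∈ A ∧ i + w i ∈ B) ∨ (i ∈ B ∧ i + w i ∈ A)
  have hgoodM : ∀ i, good i → i ∈ M := by
    rintro i (h | h) <;> simp [hM, h.1]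
  have hbad : ∀ i ∈ A, i ∈ B → good i := by
    intro i hiA hiB
    have := (hw i (by simp [hM, hiA])).2.2.1
    rcases Finset.mem_union.1 this with h | h
    · exact .inr ⟨hiB, h⟩
    · exact .inl ⟨hiA, h⟩
  have hgood2 : 2 ≤ (M.filter good).card := by
    obtain ⟨a, ha⟩ := hA
    obtain ⟨b, hb⟩ := hB
    have hne : ∃ a ∈ A, ∃ b ∈ B, a ≠ b := by
      by_contra! h
      obtain ⟨j, hj, hja⟩ := Finset.exists_mem_ne (by omega : 1 < M.card) a
      rcases Finset.mem_union.1 hj with hj | hj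
      · exact hja (by rw [h j hj b hb, h a ha b hb])
      · exact hja (h a ha j hj).symm
    obtain ⟨i, hi, k, h0, -, hik, hl⟩ := ZMod.exists_closest A B hne
    obtain ⟨j, hj, m, h0', -, hjm, hl'⟩ := ZMod.exists_closest B A (by
      obtain ⟨a, ha, b, hb, hab⟩ := hne
      exact ⟨b, hb, a, ha, hab.symm⟩)
    have hkw := hwu i (by simp [hM, hi]) k h0 (by simp [hM, hik]) (fun l h1 h2 => by
      simpa [hM] using hl l h1 h2)
    have hmw := hwu j (by simp [hM, hj]) m h0' (by simp [hM, hjm]) (fun l h1 h2 => by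
      simpa [hM, and_comm] using hl' l h1 h2)
    have gi : good i := .inl ⟨hi, hkw ▸ hik⟩
    have gj : good j := .inr ⟨hj, hmw ▸ hjm⟩
    rw [Nat.succ_le_iff, Finset.one_lt_card]
    by_cases hij : i = j
    -- Here `i` is in both sets, so the gap that ends at `i` is good too, and it starts at some `t ≠
    -- i`.
    · subst hij
      obtain ⟨s, hs, hsi⟩ := Finset.exists_mem_ne (by omega : 1 < M.card) i
      obtain ⟨t, ht, k', h0'', -, htk, hl''⟩ := ZMod.exists_closest (M.erase i) {i}
        ⟨s, by simp [hs, hsi], i, by simp, hsi⟩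
      rw [Finset.mem_singleton] at htk
      rw [Finset.mem_erase] at ht
      have hkw' := hwu t ht.2 k' h0'' (by rw [htk]; simp [hM, hi]) (fun l h1 h2 h3 => by
        have := hl'' l h1 h2
        simp only [Finset.mem_erase, Finset.mem_singleton] at this
        exact this.1 ⟨this.2, h3⟩)
      refine ⟨i, by simp [gi, hgoodM], t, ?_, ht.1.symm⟩
      rw [Finset.mem_filter]
      refine ⟨ht.2, ?_⟩
      rcases Finset.mem_union.1 ht.2 with h | h
      · exact .inl ⟨h, by rw [← hkw', htk]; exact hj⟩
      · exact .inr ⟨h, by rw [← hkw', htk]; exact hi⟩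
    · exact ⟨i, by simp [gi, hgoodM], j, by simp [gj, hgoodM], hij⟩
  refine ⟨(M.filter good).card, (A.filter fun i => ¬ good i).card,
    (B.filter fun i => ¬ good i).card, hgood2, ?_, ?_, ?_⟩
  · rw [← Finset.card_filter_add_card_filter_not (s := A) good]
    gcongr
    exact Finset.subset_union_left
  · rw [← Finset.card_filter_add_card_filter_not (s := B) good]
    gcongr
    exact Finset.subset_union_right
  · have hdisj : Disjoint (A.filter fun i => ¬ good i) (B.filter fun i => ¬ good i) := by
      rw [Finset.disjoint_left]
      intro i hi hi'
      rw [Finset.mem_filter] at hi hi'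
      exact hi.2 (hbad i hi.1 hi'.1)
    have hun : (M.filter fun i => ¬ good i).card =
        (A.filter fun i => ¬ good i).card + (B.filter fun i => ¬ good i).card := by
      rw [← Finset.card_union_of_disjoint hdisj, hM, Finset.filter_union]
    have hs : ∑ i ∈ M.filter good, w i + ∑ i ∈ M.filter (fun i => ¬ good i), w i = ∑ i ∈ M, w i :=
      Finset.sum_filter_add_sum_filter_not M good w
    have s1 : (M.filter good).card * (p + 2) ≤ ∑ i ∈ M.filter good, w i := by
      rw [← smul_eq_mul]
      refine Finset.card_nsmul_le_sum _ _ _ fun i hi => ?_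
      rw [Finset.mem_filter] at hi
      obtain ⟨h0, hc, -, -⟩ := hw i hi.1
      rcases hi.2 with h | h
      · exact hAB i h.1 _ h0 hc h.2
      · exact hBA i h.1 _ h0 hc h.2
    have s2 : (M.filter fun i => ¬ good i).card * 2 ≤ ∑ i ∈ M.filter fun i => ¬ good i, w i := by
      rw [← smul_eq_mul]
      refine Finset.card_nsmul_le_sum _ _ _ fun i hi => ?_
      rw [Finset.mem_filter] at hi
      obtain ⟨h0, hc, h, -⟩ := hw i hi.1
      exact h2 i hi.1 _ h0 hc h
    omega

/-! ### Rerouting paths by 2-connectivity. -/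

namespace SimpleGraph

variable {V : Type*} [DecidableEq V] {G : SimpleGraph V}

/-- If a path leads from `X` to a vertex `a` of a set `S` off `X` in which every other vertex can
be reached from `a` by a path covering `N`, then some path joining distinct vertices of `X`
through vertices off `X` covers `N`. -/
lemma PathOn.exists_covering
    (hG : ∀ u a b : V, a ≠ u → b ≠ u → ∃ T, PathOn G a b T ∧ u ∉ T) (X N : Finset V)
    (x a : V) (Q S : Finset V) (hQ : PathOn G x a Q) (hx : x ∈ X)
    (hQX : ∀ z ∈ Q, z ∈ X → z = x) (haS : a ∈ S) (hSQ : ∀ z ∈ S, z ∈ Q → z = a)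
    (hSX : ∀ z ∈ S, z ∈ X → z = a) (hS : ∃ s ∈ S, s ≠ a)
    (hgood : ∀ r ∈ S, r ≠ a → ∃ T, PathOn G a r T ∧ T ⊆ S ∧ N ⊆ T) (hX : ∃ y ∈ X, y ≠ x) :
    ∃ x ∈ X, ∃ y ∈ X, ∃ T, x ≠ y ∧ PathOn G x y T ∧ (∀ t ∈ T, t ∈ X → t = x ∨ t = y) ∧ N ⊆ T := by
  induction hn : Q.card using Nat.strong_induction_on generalizing a Q S with
  | _ n ih =>
  -- Since `a` is not a cut vertex, some path leaves `S` away from `a` and reaches `X ∪ Q` without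
  -- meeting `a`.
  have hR : ∃ r y R, PathOn G r y R ∧ r ∈ S ∧ r ≠ a ∧ (y ∈ X ∨ y ∈ Q) ∧ y ≠ a ∧ a ∉ R ∧
      (∀ z ∈ R, z ∈ S → z = r) ∧ ∀ z ∈ R, (z ∈ X ∨ z ∈ Q) → z = y := by
    obtain ⟨s, hs, hsa⟩ := hS
    have hx0 : ∃ x₀ ∈ X, x₀ ≠ a := by
      by_cases hxa : x = a
      · obtain ⟨y, hy, hyx⟩ := hX
        exact ⟨y, hy, hxa ▸ hyx⟩
      · exact ⟨x, hx, hxa⟩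
    obtain ⟨x₀, hx₀, hxa⟩ := hx0
    obtain ⟨T, hT, haT⟩ := hG a s x₀ hsa hxa
    obtain ⟨y, T₁, T₂, h1, -, hT12, -, hy, hy'⟩ := hT.first_hit (fun z => z ∈ X ∨ z ∈ Q)
      ⟨x₀, hT.right_mem, .inl hx₀⟩
    obtain ⟨r, R, R', h3, -, hR, -, hr, hr'⟩ := h1.symm.first_hit (· ∈ S) ⟨s, h1.left_mem, hs⟩
    have hRT : ∀ z ∈ R, z ∈ T₁ := fun z hz => by rw [hR]; simp [hz]
    have hTT : ∀ z ∈ T₁, z ≠ a := fun z hz hza => haT (by rw [hT12, ← hza]; simp [hz])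
    exact ⟨r, y, R, h3.symm, hr, hTT r (hRT r h3.right_mem), hy, hTT y (hRT y h3.left_mem),
      fun h => hTT a (hRT a h) rfl, hr', fun z hz => hy' z (hRT z hz)⟩
  obtain ⟨r, y, R, hR, hrS, hra, hy, hya, haR, hRS, hRXQ⟩ := hR
  obtain ⟨T₀, hT₀, hT₀S, hNT₀⟩ := hgood r hrS hra
  by_cases hyQ : y ∈ Q
  -- `R` returns to `Q`: shorten `Q` to end at `y` and absorb `R` and `Q₂` into `S`. Now `Q₂`, `T₀`
  -- and `R` form a cycle through `y`, which can be traversed in either direction, so the covering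
  -- property persists.
  · obtain ⟨Q₁, Q₂, hQ₁, hQ₂, rfl, hQ12⟩ := hQ.split hyQ
    have haQ₁ : a ∉ Q₁ := fun h => hya (hQ12 a h hQ₂.right_mem).symm
    have hax : a ≠ x := fun h => haQ₁ (h ▸ hQ₁.left_mem)
    have haX : a ∉ X := fun h => hax (hQX a (by simp [hQ₂.right_mem]) h)
    have hSX' : ∀ z ∈ S, z ∉ X := fun z hz hzX => haX (hSX z hz hzX ▸ hzX)
    refine ih Q₁.card ?_ y Q₁ (S ∪ R ∪ Q₂) hQ₁ (fun z hz => hQX z (by simp [hz]))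
      (by simp [hQ₂.left_mem]) ?_ ?_ ⟨a, by simp [haS], hya.symm⟩ ?_ rfl
    · rw [← hn]
      refine Finset.card_lt_card (Finset.ssubset_iff_subset_ne.2 ⟨Finset.subset_union_left, ?_⟩)
      intro h
      exact haQ₁ (h ▸ Finset.mem_union_right _ hQ₂.right_mem)
    · intro z hz hzQ
      simp only [Finset.mem_union] at hz
      rcases hz with (hz | hz) | hz
      · have := hSQ z hz (by simp [hzQ])
        exact absurd (this ▸ hzQ) haQ₁
      · exact hRXQ z hz (.inr (by simp [hzQ]))
      · exact hQ12 z hzQ hz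
    · intro z hz hzX
      simp only [Finset.mem_union] at hz
      rcases hz with (hz | hz) | hz
      · exact absurd hzX (hSX' z hz)
      · exact hRXQ z hz (.inl hzX)
      · have := hQX z (by simp [hz]) hzX
        subst this
        exact hQ12 z hQ₁.left_mem hz
    · -- paths from `y` along the path to `a`, or along `R`
      have fwd : ∀ r' T, PathOn G a r' T → T ⊆ S → PathOn G y r' (Q₂ ∪ T) := fun r' T hT hTS =>
        hQ₂.append hT fun z hz hzT => hSQ z (hTS hzT) (by simp [hz])
      intro r' hr' hr'y
      by_cases hr'Q : r' ∈ Q₂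
      · obtain ⟨Q₃, Q₄, hQ₃, hQ₄, rfl, hQ34⟩ := hQ₂.split hr'Q
        have h1 := hR.symm.append hT₀.symm fun z hz hzT => hRS z hz (hT₀S hzT)
        refine ⟨_, h1.append hQ₄.symm ?_, ?_, ?_⟩
        · intro z hz hzQ
          rcases Finset.mem_union.1 hz with hz | hz
          · have := hRXQ z hz (.inr (by simp [hzQ]))
            subst this
            exact absurd (hQ34 z hQ₃.left_mem hzQ).symm hr'y
          · exact hSQ z (hT₀S hz) (by simp [hzQ])
        · intro z hz
          simp only [Finset.mem_union] at hz ⊢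
          rcases hz with (hz | hz) | hz
          · simp [hz]
          · simp [hT₀S hz]
          · simp [hz]
        · intro z hz
          simp [hNT₀ hz]
      · by_cases hr'S : r' ∈ S
        · have hr'a : r' ≠ a := fun h => hr'Q (h ▸ hQ₂.right_mem)
          obtain ⟨T, hT, hTS, hNT⟩ := hgood r' hr'S hr'a
          refine ⟨_, fwd r' T hT hTS, ?_, ?_⟩
          · intro z hz
            simp only [Finset.mem_union] at hz ⊢
            rcases hz with hz | hz
            · simp [hz]
            · simp [hTS hz]
          · intro z hz
            simp [hNT hz]
        · have hr'R : r' ∈ R := by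
            simp only [Finset.mem_union] at hr'
            tauto
          obtain ⟨R₁, R₂, hR₁, hR₂, rfl, hR12⟩ := hR.split hr'R
          refine ⟨_, (fwd r T₀ hT₀ hT₀S).append hR₁ ?_, ?_, ?_⟩
          · intro z hz hzR
            rcases Finset.mem_union.1 hz with hz | hz
            · have := hRXQ z (by simp [hzR]) (.inr (by simp [hz]))
              subst this
              exact absurd (hR12 z hzR hR₂.right_mem).symm hr'y
            · exact hRS z (by simp [hzR]) (hT₀S hz)
          · intro z hz
            simp only [Finset.mem_union] at hz ⊢
            rcases hz with (hz | hz) | hz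
            · simp [hz]
            · simp [hT₀S hz]
            · simp [hz]
          · intro z hz
            simp [hNT₀ hz]
  · have hyX : y ∈ X := hy.resolve_right hyQ
    have hxy : x ≠ y := fun h => hyQ (h ▸ hQ.left_mem)
    have h1 := hQ.append hT₀ fun z hz hzT => hSQ z (hT₀S hzT) hz
    refine ⟨x, hx, y, hyX, _, hxy, h1.append hR ?_, ?_, ?_⟩
    · intro z hz hzR
      rcases Finset.mem_union.1 hz with hz | hz
      · have := hRXQ z hzR (.inr hz)
        exact absurd (this ▸ hz) hyQ
      · exact hRS z hzR (hT₀S hz)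
    · intro z hz hzX
      simp only [Finset.mem_union] at hz
      rcases hz with (hz | hz) | hz
      · exact .inl (hQX z hz hzX)
      · have h2 := hSX z (hT₀S hz) hzX
        subst h2
        exact .inl (hQX z hQ.right_mem hzX)
      · exact .inr (hRXQ z hz (.inl hzX))
    · intro z hz
      simp [hNT₀ hz]

/-- A path whose last vertex `w` has all its neighbours on the path or in `X` can be rerouted into
a path with both ends in `X` which covers the closed neighbourhood of `w`. -/
lemma PathOn.exists_covering_neighbors
    (hG : ∀ u a b : V, a ≠ u → b ≠ u → ∃ T, PathOn G a b T ∧ u ∉ T) (X N : Finset V)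
    {x w : V} {Q : Finset V} (hQ : PathOn G x w Q) (hx : x ∈ X) (hw : w ∉ X)
    (hQX : ∀ z ∈ Q, z ∈ X → z = x) (hX : ∃ y ∈ X, y ≠ x)
    (hN : ∀ z ∈ N, z = w ∨ (G.Adj z w ∧ z ∈ Q)) :
    ∃ x ∈ X, ∃ y ∈ X, ∃ T, x ≠ y ∧ PathOn G x y T ∧ (∀ t ∈ T, t ∈ X → t = x ∨ t = y) ∧ N ⊆ T := by
  have hxw : x ≠ w := fun h => hw (h ▸ hx)
  obtain ⟨w', hww', hw'⟩ := hQ.symm.exists_tail hxw.symm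
  -- Let `a` be the first neighbour of `w` on the path. For `r` beyond `a`, let `l` be the last
  -- neighbour before `r`: go from `a` to `l`, jump to `w` and return to `r`. Only non-neighbours
  -- between `l` and `r` are skipped.
  obtain ⟨a, Q₁, Q₂, hQ₁, hQ₂, rfl, hQ12, haw, ha⟩ := hQ.first_hit (G.Adj · w)
    ⟨w', Finset.mem_of_mem_erase hw'.left_mem, hww'.symm⟩
  have haw' : w ≠ a := haw.ne'
  refine PathOn.exists_covering hG X N x a Q₁ Q₂ hQ₁ hx (fun z hz => hQX z (by simp [hz]))
    hQ₂.left_mem (fun z hz hz' => hQ12 z hz' hz) ?_ ⟨w, hQ₂.right_mem, haw'⟩ ?_ hX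
  · intro z hz hzX
    have := hQX z (by simp [hz]) hzX
    subst this
    exact hQ12 z hQ₁.left_mem hz
  · intro r hr hra
    obtain ⟨T₁, T₂, hT₁, hT₂, rfl, hT12⟩ := hQ₂.split hr
    obtain ⟨r', hrr', hr'⟩ := hT₁.symm.exists_tail hra
    obtain ⟨l, L₁, L₂, hL₁, hL₂, hL, hL12, hlw, hl⟩ := hr'.first_hit (G.Adj · w)
      ⟨a, hr'.right_mem, haw⟩
    have hLT : ∀ z ∈ L₂, z ∈ T₁ ∧ z ≠ r := fun z hz => by
      have : z ∈ T₁.erase r := by rw [hL]; simp [hz]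
      rw [Finset.mem_erase] at this
      exact this.symm
    refine ⟨_, hL₂.symm.join hlw hT₂.symm ?_, ?_, ?_⟩
    · rw [Finset.disjoint_left]
      exact fun z hz hz' => (hLT z hz).2 (hT12 z (hLT z hz).1 hz')
    · intro z hz
      rw [Finset.mem_union] at hz ⊢
      exact hz.imp (fun h => (hLT z h).1) id
    · intro z hz
      rw [Finset.mem_union]
      rcases hN z hz with rfl | ⟨hzw, hzQ⟩
      · exact .inr hT₂.right_mem
      · simp only [Finset.mem_union] at hzQ
        rcases hzQ with hzQ | hzQ | hzQ
        · rw [ha z hzQ hzw]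
          exact .inl hL₂.right_mem
        · by_cases hzr : z = r
          · exact .inr (hzr ▸ hT₂.left_mem)
          · have : z ∈ T₁.erase r := by simp [hzQ, hzr]
            rw [hL, Finset.mem_union] at this
            rcases this with h | h
            · rw [hl z h hzw]
              exact .inl hL₂.left_mem
            · exact .inl h
        · exact .inr hzQ

/-! ### Cyclic enumeration of a cycle. -/

/-- Enumeration of the vertices of a path. -/
lemma PathOn.exists_enum {a b : V} {T : Finset V} (h : PathOn G a b T) :
    ∃ f : ℕ → V, f 0 = a ∧ f (T.card - 1) = b ∧ (∀ i, i + 1 < T.card → G.Adj (f i) (f (i + 1))) ∧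
      (∀ x, x ∈ T ↔ ∃ i < T.card, f i = x) := by
  induction h with
  | single a => exact ⟨fun _ => a, rfl, rfl, by simp, fun x => by simp [eq_comm]⟩
  | @cons a y b T hay ha h ih =>
    obtain ⟨f, h0, hl, hadj, hT⟩ := ih
    have hpos : 0 < T.card := Finset.card_pos.2 ⟨_, h.left_mem⟩
    refine ⟨fun n => Nat.casesOn n a f, rfl, ?_, ?_, ?_⟩ <;>
      rw [Finset.card_insert_of_notMem ha]
    · obtain ⟨m, hm⟩ := Nat.exists_eq_succ_of_ne_zero hpos.ne'
      rw [hm] at hl ⊢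
      exact hl
    · rintro (_ | i) hi
      · simpa [h0] using hay
      · exact hadj i (by omega)
    · intro x
      rw [Finset.mem_insert, hT]
      constructor
      · rintro (rfl | ⟨i, hi, rfl⟩)
        · exact ⟨0, by omega, rfl⟩
        · exact ⟨i + 1, by omega, rfl⟩
      · rintro ⟨_ | i, hi, rfl⟩
        · exact .inl rfl
        · exact .inr ⟨i, by omega, rfl⟩

/-- Cyclic enumeration of the vertices of a cycle. -/
lemma CycleOn.exists_enum {U : Finset V} (h : CycleOn G U) :
    ∃ f : ZMod U.card → V, Function.Injective f ∧ (∀ i, G.Adj (f i) (f (i + 1))) ∧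
      (∀ x, x ∈ U ↔ ∃ i, f i = x) := by
  obtain ⟨h3, a, b, hU, hba⟩ := h
  have : NeZero U.card := ⟨by omega⟩
  obtain ⟨f, h0, hl, hadj, hT⟩ := hU.exists_enum
  have hmem : ∀ x, x ∈ U ↔ ∃ i : ZMod U.card, f i.val = x := by
    intro x
    rw [hT]
    constructor
    · rintro ⟨i, hi, rfl⟩
      exact ⟨i, by rw [ZMod.val_cast_of_lt hi]⟩
    · rintro ⟨i, rfl⟩
      exact ⟨i.val, ZMod.val_lt i, rfl⟩
  refine ⟨fun i => f i.val, ?_, ?_, hmem⟩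
  · have hsurj : Function.Surjective (fun i : ZMod U.card => (⟨f i.val, (hmem _).2 ⟨i, rfl⟩⟩ : U)) := by
      rintro ⟨x, hx⟩
      obtain ⟨i, hi⟩ := (hmem x).1 hx
      exact ⟨i, Subtype.ext hi⟩
    have hbij := (Fintype.bijective_iff_surjective_and_card _).2 ⟨hsurj, by simp [ZMod.card]⟩
    intro i j hij
    exact hbij.1 (Subtype.ext hij)
  · intro i
    by_cases hi : i.val + 1 < U.card
    · have : Fact (1 < U.card) := ⟨by omega⟩
      have : (i + 1).val = i.val + 1 := by
        rw [ZMod.val_add_of_lt] <;> rw [ZMod.val_one]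
        exact hi
      simp only [this]
      exact hadj _ hi
    · have hv := ZMod.val_lt i
      have hv' : i.val = U.card - 1 := by omega
      have : i + 1 = 0 := by
        rw [← ZMod.natCast_zmod_val i, hv', Nat.cast_sub (by omega)]
        simp
      simp only [this, hv', hl, ZMod.val_zero, h0]
      exact hba

lemma PathOn.of_enum {c : ℕ} [NeZero c] {f : ZMod c → V} (hf : Function.Injective f)
    (hadj : ∀ i, G.Adj (f i) (f (i + 1))) (i : ZMod c) (m : ℕ) (hm : m < c) :
    PathOn G (f i) (f (i + m)) ((Finset.range (m + 1)).image fun j : ℕ => f (i + j)) := by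
  induction m with
  | zero => simpa using PathOn.single (G := G) (f i)
  | succ m ih =>
    rw [Finset.range_add_one, Finset.image_insert]
    have h := hadj (i + m)
    rw [add_assoc] at h
    push_cast
    have hni : f (i + (m + 1)) ∉ (Finset.range (m + 1)).image fun j : ℕ => f (i + j) := by
      intro hmem
      obtain ⟨j, hj, he⟩ := Finset.mem_image.1 hmem
      rw [Finset.mem_range] at hj
      have he := add_left_cancel (hf he)
      have he' : ((j : ℕ) : ZMod c) = ((m + 1 : ℕ) : ZMod c) := by exact_mod_cast he
      have := congrArg ZMod.val he'
      rw [ZMod.val_cast_of_lt (by omega), ZMod.val_cast_of_lt (by omega)] at this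
      omega
    exact (ih (by omega)).concat h hni

end SimpleGraph

namespace SimpleGraph

/-! ### Exchanging arcs of a longest cycle. -/

section Exchange

variable {V : Type*} [DecidableEq V] {G : SimpleGraph V} {c : ℕ} [NeZero c] {f : ZMod c → V}

/-- A path with its ends on a longest cycle and otherwise off it is at most as long as the segments
of the cycle between its ends, and shorter if it contains a vertex which lies on no longest
cycle. -/
lemma PathOn.card_le_of_longest (hf : Function.Injective f)
    (hadj : ∀ i, G.Adj (f i) (f (i + 1))) (h3 : 3 ≤ c)
    (hmax : ∀ U, CycleOn G U → U.card ≤ c) {i : ZMod c} {k : ℕ} (hk0 : 0 < k) (hk : k < c)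
    {T : Finset V} (hT : PathOn G (f i) (f (i + k)) T)
    (hTf : ∀ j, f j ∈ T → j = i ∨ j = i + k) :
    T.card ≤ k + 1 ∧ ∀ v ∈ T, (∀ U, CycleOn G U → U.card = c → v ∉ U) → T.card ≤ k := by
  -- The complementary arc, from `f (i + k)` onwards to `f i`, has `c - k + 1` vertices.
  have hS := PathOn.of_enum hf hadj (i + k) (c - k) (by omega)
  have hi : i + k + ((c - k : ℕ) : ZMod c) = i := by
    rw [Nat.cast_sub hk.le]
    simp
  rw [hi] at hS
  set S := (Finset.range (c - k + 1)).image fun j : ℕ => f (i + k + j) with hSdef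
  have hScard : S.card = c - k + 1 := by
    rw [hSdef, Finset.card_image_of_injOn, Finset.card_range]
    intro a ha b hb hab
    simp only [Finset.coe_range, Set.mem_Iio] at ha hb
    have := congrArg ZMod.val (add_left_cancel (hf hab))
    rwa [ZMod.val_cast_of_lt (by omega), ZMod.val_cast_of_lt (by omega)] at this
  have hne : f i ≠ f (i + k) := by
    intro h
    have h1 : (k : ZMod c) = 0 := by simpa using hf h
    rw [ZMod.natCast_eq_zero_iff] at h1
    exact absurd (Nat.le_of_dvd hk0 h1) (by omega)
  have hTS : ∀ z ∈ T, z ∈ S → z = f i ∨ z = f (i + k) := by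
    intro z hz hzS
    obtain ⟨j, -, rfl⟩ := Finset.mem_image.1 hzS
    exact (hTf _ hz).imp (congrArg f) (congrArg f)
  have hinter : (T ∩ S).card ≤ 2 := by
    refine (Finset.card_le_card (t := {f i, f (i + k)}) fun z hz => ?_).trans Finset.card_le_two
    rw [Finset.mem_inter] at hz
    simpa using hTS z hz.1 hz.2
  have hcard := Finset.card_union_add_card_inter T S
  have hcyc : k + 1 ≤ T.card → CycleOn G (T ∪ S) := fun h =>
    hT.cycleOn_union hS hne hTS (by omega)
  refine ⟨?_, fun v hv hvU => ?_⟩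
  · by_contra! h
    have := hmax _ (hcyc (by omega))
    omega
  · by_contra! h
    have := hmax _ (hcyc (by omega))
    exact hvU _ (hcyc (by omega)) (by omega) (by simp [hv])

/-- Adding both attachment points reduces this to `PathOn.card_le_of_longest`, with two more
vertices. -/
lemma PathOn.card_add_one_le_of_longest (hf : Function.Injective f)
    (hadj : ∀ i, G.Adj (f i) (f (i + 1))) (h3 : 3 ≤ c)
    (hmax : ∀ U, CycleOn G U → U.card ≤ c) {i : ZMod c} {k : ℕ} (hk0 : 0 < k) (hk : k < c)
    {T : Finset V} {u w : V} (hT : PathOn G u w T) (hu : G.Adj u (f i)) (hw : G.Adj w (f (i + k)))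
    (hTf : ∀ j, f j ∉ T) :
    T.card + 1 ≤ k ∧
      ∀ v ∈ T, (∀ U, CycleOn G U → U.card = c → v ∉ U) → T.card + 2 ≤ k := by
  have hne : f (i + k) ≠ f i := by
    intro h
    have h1 : (k : ZMod c) = 0 := by simpa using hf h
    rw [ZMod.natCast_eq_zero_iff] at h1
    exact absurd (Nat.le_of_dvd hk0 h1) (by omega)
  have h := PathOn.card_le_of_longest hf hadj h3 hmax hk0 hk
    ((PathOn.cons hu.symm (hTf i) hT).concat hw (by simp [hne, hTf])) (by
      intro j hj
      simp only [Finset.mem_insert, hTf, or_false] at hj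
      exact hj.symm.imp (fun h => hf h) (fun h => hf h))
  rw [Finset.card_insert_of_notMem (by simp [hne, hTf]), Finset.card_insert_of_notMem (hTf i)] at h
  refine ⟨by omega, fun v hv hvU => ?_⟩
  have := h.2 v (by simp [hv]) hvU
  omega

end Exchange

/-- Two distinct neighbours of `v` are joined by a path avoiding `v`. The second neighbour starts a
path from `v` that avoids the first. -/
lemma IsKConnected.exists_cycleOn {V : Type*} [DecidableEq V] [Fintype V] {G : SimpleGraph V}
    (hG : G.IsKConnected 2) : ∃ U, CycleOn G U := by
  obtain ⟨v, x, z, hvx, hvz, hxz⟩ := Fintype.two_lt_card_iff.1 hG.1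
  obtain ⟨T, hT, -⟩ := hG.exists_pathOn hvz hxz
  obtain ⟨a, hva, -⟩ := hT.exists_tail hvx
  obtain ⟨y, hya⟩ : ∃ y, y ≠ v ∧ y ≠ a := by
    by_cases hxa : x = a
    · exact ⟨z, hvz.symm, hxa ▸ hxz.symm⟩
    · exact ⟨x, hvx.symm, hxa⟩
  obtain ⟨T', hT', haT'⟩ := hG.exists_pathOn hva.ne hya.2
  obtain ⟨b, hvb, hT''⟩ := hT'.exists_tail hya.1.symm
  have hba : b ≠ a := fun h => haT' (h ▸ Finset.mem_of_mem_erase hT''.left_mem)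
  obtain ⟨S, hS, hvS⟩ := hG.exists_pathOn hva.ne' hvb.ne'
  refine ⟨insert v S, ?_, v, b, .cons hva hvS hS, hvb.symm⟩
  rw [Finset.card_insert_of_notMem hvS]
  have : 1 < S.card := Finset.one_lt_card.2 ⟨a, hS.left_mem, b, hS.right_mem, hba.symm⟩
  omega

/-! ### The degree condition. -/

section Main

variable {V : Type*} [DecidableEq V] [Fintype V] {G : SimpleGraph V} [DecidableRel G.Adj]
  {c : ℕ} [NeZero c] {f : ZMod c → V}

lemma degree_le_card_filter_add (f : ZMod c → V) (w : V) (S : Finset V)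
    (hS : ∀ z, G.Adj w z → (∃ i, f i = z) ∨ z ∈ S) :
    G.degree w ≤ (Finset.univ.filter fun i => G.Adj w (f i)).card + S.card := by
  rw [← card_neighborFinset_eq_degree]
  calc (G.neighborFinset w).card
      ≤ ((Finset.univ.filter fun i => G.Adj w (f i)).image f ∪ S).card := by
        refine Finset.card_le_card fun z hz => ?_
        rw [mem_neighborFinset] at hz
        rw [Finset.mem_union]
        refine (hS z hz).imp_left ?_
        rintro ⟨i, rfl⟩
        exact Finset.mem_image_of_mem _ (by simpa using hz)
    _ ≤ _ := (Finset.card_union_le _ _).trans (by gcongr; exact Finset.card_image_le)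

/-- If some vertex lies on no longest cycle of a 2-connected graph, then the longest cycles have
length at least `2δ + 2`. -/
lemma IsKConnected.two_mul_add_two_le (hG : G.IsKConnected 2) (hf : Function.Injective f)
    (hadj : ∀ i, G.Adj (f i) (f (i + 1))) (h3 : 3 ≤ c)
    (hmax : ∀ U, CycleOn G U → U.card ≤ c) {v : V} (hvf : ∀ i, f i ≠ v)
    (hv : ∀ U, CycleOn G U → U.card = c → v ∉ U) {d : ℕ} (hd : ∀ x, d ≤ G.degree x) :
    2 * d + 2 ≤ c := by
  have hpath : ∀ u a b : V, a ≠ u → b ≠ u → ∃ T, PathOn G a b T ∧ u ∉ T :=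
    fun u a b ha hb => hG.exists_pathOn ha hb
  set X : Finset V := Finset.univ.image f with hX
  have hmemX : ∀ z, z ∈ X ↔ ∃ i, f i = z := by simp [hX]
  have hvX : v ∉ X := by simpa [hmemX] using hvf
  let 𝒯 : Finset (Finset V) := by
    classical
    exact Finset.univ.filter fun T => v ∈ T ∧
      ∃ x w, PathOn G x w T ∧ x ∈ X ∧ w ∉ X ∧ ∀ z ∈ T, z ∈ X → z = x
  have h𝒯 : ∀ T, T ∈ 𝒯 ↔ v ∈ T ∧
      ∃ x w, PathOn G x w T ∧ x ∈ X ∧ w ∉ X ∧ ∀ z ∈ T, z ∈ X → z = x := by simp [𝒯]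
  have hne01 : f 0 ≠ f 1 := by
    have := (hadj 0).ne
    rwa [zero_add] at this
  have hne : 𝒯.Nonempty := by
    obtain ⟨T, hT, -⟩ := hpath (f 1) v (f 0) (hvf 1).symm hne01
    obtain ⟨x, T₁, T₂, h1, -, -, -, hx, hx'⟩ := hT.first_hit (· ∈ X)
      ⟨f 0, hT.right_mem, (hmemX _).2 ⟨0, rfl⟩⟩
    exact ⟨T₁, (h𝒯 _).2 ⟨h1.left_mem, x, v, h1.symm, hx, hvX, hx'⟩⟩
  obtain ⟨T, hT𝒯, hTmax⟩ := 𝒯.exists_max_image Finset.card hne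
  obtain ⟨hvT, x, w, hT, hxX, hwX, hTX⟩ := (h𝒯 _).1 hT𝒯
  have hwT : ∀ z, G.Adj w z → z ∉ X → z ∈ T := by
    intro z hwz hz
    by_contra hzT
    have := hTmax (insert z T) ((h𝒯 _).2 ⟨by simp [hvT], x, z, hT.concat hwz hzT, hxX, hz, by
      intro y hy hyX
      rcases Finset.mem_insert.1 hy with rfl | hy
      · exact absurd hyX hz
      · exact hTX y hy hyX⟩)
    rw [Finset.card_insert_of_notMem hzT] at this
    omega
  have hxw : x ≠ w := fun h => hwX (h ▸ hxX)
  by_cases hy : ∃ y ∈ X, y ≠ x ∧ G.Adj w y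
  · obtain ⟨i₀, hi₀⟩ := (hmemX x).1 hxX
    obtain ⟨y, hyX, hyx, hwy⟩ := hy
    obtain ⟨j₀, rfl⟩ := (hmemX y).1 hyX
    obtain ⟨u, hxu, hT'⟩ := hT.exists_tail hxw
    have hfT : ∀ j, f j ∉ T.erase x := by
      intro j hj
      rw [Finset.mem_erase] at hj
      exact hj.1 (hTX _ hj.2 ((hmemX _).2 ⟨j, rfl⟩))
    have hTcard : (T.erase x).card = T.card - 1 := Finset.card_erase_of_mem hT.left_mem
    have hT2 : 2 ≤ T.card := Finset.one_lt_card.2 ⟨x, hT.left_mem, w, hT.right_mem, hxw⟩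
    have hvT' : v ∈ T.erase x := Finset.mem_erase.2 ⟨fun h => hvX (h ▸ hxX), hvT⟩
    have hdeg := degree_le_card_filter_add (G := G) f w ((T.erase x).erase w) (by
      intro z hz
      by_cases hzX : z ∈ X
      · exact .inl ((hmemX z).1 hzX)
      · exact .inr (by
          simp only [Finset.mem_erase]
          exact ⟨hz.ne', fun h => hzX (h ▸ hxX), hwT z hz hzX⟩))
    rw [Finset.card_erase_of_mem hT'.right_mem, hTcard] at hdeg
    have hAB : ∀ i ∈ ({i₀} : Finset (ZMod c)), ∀ k : ℕ, 0 < k → k < c →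
        i + k ∈ (Finset.univ.filter fun i => G.Adj w (f i)) → T.card - 1 + 2 ≤ k := by
      intro i hi k h0 hk hik
      rw [Finset.mem_singleton] at hi
      subst hi
      have := (PathOn.card_add_one_le_of_longest hf hadj h3 hmax h0 hk hT' (hi₀ ▸ hxu.symm)
        (by simpa using hik) hfT).2 v hvT' hv
      omega
    have hBA : ∀ i ∈ (Finset.univ.filter fun i => G.Adj w (f i)), ∀ k : ℕ, 0 < k → k < c →
        i + k ∈ ({i₀} : Finset (ZMod c)) → T.card - 1 + 2 ≤ k := by
      intro i hi k h0 hk hik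
      rw [Finset.mem_singleton] at hik
      have := (PathOn.card_add_one_le_of_longest hf hadj h3 hmax (i := i) h0 hk hT'.symm
        (by simpa using hi) (by rw [hik, hi₀]; exact hxu.symm) hfT).2 v hvT' hv
      omega
    obtain ⟨g, α, β, hg, -, hB, hc⟩ := ZMod.exists_gap_count {i₀}
      (Finset.univ.filter fun i => G.Adj w (f i)) (T.card - 1) (by simp) ⟨j₀, by simpa using hwy⟩
      (Finset.one_lt_card.2 ⟨i₀, by simp, j₀, by simp [hwy], fun h => hyx (by rw [← h, hi₀])⟩)
      (by
        intro i hi k h0 hk hik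
        rcases Finset.mem_union.1 hi with h | h <;> rcases Finset.mem_union.1 hik with h' | h'
        · rw [Finset.mem_singleton] at h h'
          rw [h] at h'
          have h1 : (k : ZMod c) = 0 := by simpa using h'
          rw [ZMod.natCast_eq_zero_iff] at h1
          exact absurd (Nat.le_of_dvd h0 h1) (by omega)
        · have := hAB i h k h0 hk h'
          omega
        · have := hBA i h k h0 hk h'
          omega
        · have := (PathOn.card_add_one_le_of_longest hf hadj h3 hmax h0 hk (.single w)
            (by simpa using h) (by simpa using h')
            (fun j hj => hwX ((hmemX w).2 ⟨j, by simpa using hj⟩))).1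
          simpa using this) hAB hBA
    have hdw := hd w
    obtain ⟨m, hm⟩ : ∃ m, T.card = m + 2 := ⟨T.card - 2, by omega⟩
    rw [hm] at hc hdeg
    have e1 : m + 2 - 1 = m + 1 := by omega
    have e2 : m + 1 - 1 = m := by omega
    rw [e1] at hc hdeg
    rw [e2] at hdeg
    -- From d ≤ g + β + m and g(m + 3) + 2α + 2β ≤ c follows c - 2d ≥ g(m + 1) - 2m ≥ 2.
    nlinarith [Nat.mul_le_mul_right (m + 1) hg]
  · push Not at hy
    have hyX : ∃ y ∈ X, y ≠ x := by
      by_contra! h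
      exact hne01 ((h _ ((hmemX _).2 ⟨0, rfl⟩)).trans (h _ ((hmemX _).2 ⟨1, rfl⟩)).symm)
    -- Removing `x` leaves at least `d` vertices, all off the cycle. The two ends on the cycle then
    -- give `d + 2`.
    set N := (insert w (G.neighborFinset w)).erase x with hN
    have hNX : ∀ z ∈ N, z ∉ X := by
      intro z hz hzX
      simp only [hN, Finset.mem_erase, Finset.mem_insert, mem_neighborFinset] at hz
      rcases hz.2 with rfl | h
      · exact hwX hzX
      · exact hy z hzX hz.1 h
    have hNcard : d ≤ N.card := by
      have h1 : (insert w (G.neighborFinset w)).card - 1 ≤ N.card :=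
        Finset.pred_card_le_card_erase
      rw [Finset.card_insert_of_notMem (by simp), card_neighborFinset_eq_degree] at h1
      have := hd w
      omega
    obtain ⟨x₁, hx₁, y₁, hy₁, S, hxy, hS, hSX, hNS⟩ :=
      hT.exists_covering_neighbors hpath X N hxX hwX hTX hyX (by
        intro z hz
        have hzX := hNX z hz
        simp only [hN, Finset.mem_erase, Finset.mem_insert, mem_neighborFinset] at hz
        exact hz.2.imp id fun h => ⟨h.symm, hwT z h hzX⟩)
    have hScard : d + 2 ≤ S.card := by
      have h1 : insert x₁ (insert y₁ N) ⊆ S := by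
        intro z hz
        simp only [Finset.mem_insert] at hz
        rcases hz with rfl | rfl | hz
        · exact hS.left_mem
        · exact hS.right_mem
        · exact hNS hz
      have h2 := Finset.card_le_card h1
      rw [Finset.card_insert_of_notMem (by
        simp only [Finset.mem_insert, not_or]
        exact ⟨hxy, fun h => hNX _ h hx₁⟩), Finset.card_insert_of_notMem fun h => hNX _ h hy₁] at h2
      omega
    -- Used in both directions: each arc between the ends has length at least `d + 1`.
    have key : ∀ i j : ZMod c, f i ≠ f j → PathOn G (f i) (f j) S →
        (∀ t ∈ S, t ∈ X → t = f i ∨ t = f j) → S.card ≤ (j - i).val + 1 := by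
      intro i j hij hSij hSX
      have hval : ((j - i).val : ZMod c) = j - i := ZMod.natCast_zmod_val _
      have e : i + ((j - i).val : ZMod c) = j := by rw [hval]; ring
      refine (PathOn.card_le_of_longest hf hadj h3 hmax (i := i) (k := (j - i).val) ?_
        (ZMod.val_lt _) (e.symm ▸ hSij) ?_).1
      · rw [Nat.pos_iff_ne_zero, Ne, ZMod.val_eq_zero, sub_eq_zero]
        exact fun h => hij (h ▸ rfl)
      · intro l hl
        rw [e]
        exact (hSX _ hl ((hmemX _).2 ⟨l, rfl⟩)).imp (fun h => hf h) (fun h => hf h)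
    obtain ⟨i, rfl⟩ := (hmemX _).1 hx₁
    obtain ⟨j, rfl⟩ := (hmemX _).1 hy₁
    have h1 := key i j hxy hS hSX
    have h2 := key j i hxy.symm hS.symm fun t ht htX => (hSX t ht htX).symm
    have h4 : (i - j).val = c - (j - i).val := by
      have hne : NeZero (j - i) := ⟨fun h => hxy (by rw [sub_eq_zero.1 h])⟩
      rw [← neg_sub, ZMod.val_neg_of_ne_zero]
    have := ZMod.val_lt (j - i)
    omega

/-- The core of the theorem: with minimum degree at least a third of the order, no vertex is missed
by all longest cycles. -/
lemma IsKConnected.exists_longest_cycleOn_mem (hG : G.IsKConnected 2) {d : ℕ}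
    (hd : ∀ x, d ≤ G.degree x) (hcard : Fintype.card V ≤ 3 * d) {U : Finset V}
    (hU : CycleOn G U) (hmax : ∀ U', CycleOn G U' → U'.card ≤ U.card) (v : V) :
    ∃ U', CycleOn G U' ∧ (∀ U'', CycleOn G U'' → U''.card ≤ U'.card) ∧ v ∈ U' := by
  by_contra! hcon
  have hv : ∀ U', CycleOn G U' → U'.card = U.card → v ∉ U' := fun U' hU' he =>
    hcon U' hU' (fun U'' h => he ▸ hmax U'' h)
  have h3 := hU.1
  have : NeZero U.card := ⟨by omega⟩
  obtain ⟨f, hf, hadj, hfU⟩ := hU.exists_enum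
  have hvU := hv U hU rfl
  have hvf : ∀ i, f i ≠ v := fun i hi => hvU ((hfU v).2 ⟨i, hi⟩)
  have hc2 := hG.two_mul_add_two_le hf hadj h3 hmax hvf hv hd
  have hn : U.card + Uᶜ.card = Fintype.card V := Finset.card_add_card_compl U
  let 𝒯 : Finset (Finset V) := by
    classical
    exact Finset.univ.filter fun T => T ⊆ Uᶜ ∧ ∃ w, PathOn G v w T
  have h𝒯 : ∀ T, T ∈ 𝒯 ↔ T ⊆ Uᶜ ∧ ∃ w, PathOn G v w T := by simp [𝒯]
  obtain ⟨T, hT𝒯, hTmax⟩ := 𝒯.exists_max_image Finset.card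
    ⟨{v}, (h𝒯 _).2 ⟨by simpa using hvU, v, .single v⟩⟩
  obtain ⟨hTU, w, hT⟩ := (h𝒯 _).1 hT𝒯
  have hwT : ∀ z, G.Adj w z → z ∉ U → z ∈ T := by
    intro z hwz hz
    by_contra hzT
    have := hTmax (insert z T) ((h𝒯 _).2 ⟨Finset.insert_subset (by simpa using hz) hTU, z,
      hT.concat hwz hzT⟩)
    rw [Finset.card_insert_of_notMem hzT] at this
    omega
  have hTc : T.card ≤ Uᶜ.card := Finset.card_le_card hTU
  have hT1 : 1 ≤ T.card := Finset.card_pos.2 ⟨v, hT.left_mem⟩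
  have hA := degree_le_card_filter_add (G := G) f v (Uᶜ.erase v) (by
    intro z hz
    by_cases hzU : z ∈ U
    · exact .inl ((hfU z).1 hzU)
    · exact .inr (by simp [hz.ne', hzU]))
  have hB := degree_le_card_filter_add (G := G) f w (T.erase w) (by
    intro z hz
    by_cases hzU : z ∈ U
    · exact .inl ((hfU z).1 hzU)
    · exact .inr (by simp [hz.ne', hwT z hz hzU]))
  rw [Finset.card_erase_of_mem (by simpa using hvU)] at hA
  rw [Finset.card_erase_of_mem hT.right_mem] at hB
  have hdv := hd v
  have hdw := hd w
  set A := Finset.univ.filter fun i => G.Adj v (f i) with hAdef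
  set B := Finset.univ.filter fun i => G.Adj w (f i) with hBdef
  have hfT : ∀ S : Finset V, S ⊆ Uᶜ → ∀ j, f j ∉ S := fun S hS j hj =>
    Finset.mem_compl.1 (hS hj) ((hfU _).2 ⟨j, rfl⟩)
  have hAB : ∀ i ∈ A, ∀ k : ℕ, 0 < k → k < U.card → i + k ∈ B → T.card + 2 ≤ k := by
    intro i hi k h0 hk hik
    exact (PathOn.card_add_one_le_of_longest hf hadj h3 hmax h0 hk hT (by simpa [hAdef] using hi)
      (by simpa [hBdef] using hik) (hfT T hTU)).2 v hT.left_mem hv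
  have hBA : ∀ i ∈ B, ∀ k : ℕ, 0 < k → k < U.card → i + k ∈ A → T.card + 2 ≤ k := by
    intro i hi k h0 hk hik
    exact (PathOn.card_add_one_le_of_longest hf hadj h3 hmax h0 hk hT.symm
      (by simpa [hBdef] using hi) (by simpa [hAdef] using hik) (hfT T hTU)).2 v hT.left_mem hv
  have hsame : ∀ u, u ∉ U → ∀ i, G.Adj u (f i) → ∀ k : ℕ, 0 < k → k < U.card →
      G.Adj u (f (i + k)) → 2 ≤ k := by
    intro u hu i hi k h0 hk hik
    have := (PathOn.card_add_one_le_of_longest hf hadj h3 hmax h0 hk (.single u) hi hik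
      (hfT {u} (by simpa using hu))).1
    simpa using this
  have hwU : w ∉ U := Finset.mem_compl.1 (hTU hT.right_mem)
  -- By `hc2` at most `d - 2` vertices are off the cycle, which forces neighbours of `v` and `w` on
  -- it. The case `w = v` is allowed.
  have hB2 : 2 ≤ B.card := by omega
  obtain ⟨g, α, β, hg, hAc, hBc, hc⟩ := ZMod.exists_gap_count A B T.card
    (Finset.card_pos.1 (by omega)) (Finset.card_pos.1 (by omega))
    (hB2.trans (Finset.card_le_card Finset.subset_union_right))
    (by
      intro i hi k h0 hk hik
      rcases Finset.mem_union.1 hi with h | h <;> rcases Finset.mem_union.1 hik with h' | h'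
      · exact hsame v hvU i (by simpa [hAdef] using h) k h0 hk (by simpa [hAdef] using h')
      · have := hAB i h k h0 hk h'
        omega
      · have := hBA i h k h0 hk h'
        omega
      · exact hsame w hwU i (by simpa [hBdef] using h) k h0 hk (by simpa [hBdef] using h')) hAB hBA
  -- With p = |T|, c ≥ 3g' + 2p + 4 + 2α + 2β. Inserting β ≥ d - g' - p - 1 twice and α ≥ d - g' - 1
  -- - n + c once, with α ≥ 0, gives n ≥ 3d + 1.
  obtain ⟨g', rfl⟩ : ∃ g', g = g' + 2 := ⟨g - 2, by omega⟩
  have hmul : g' ≤ g' * T.card := Nat.le_mul_of_pos_right _ hT1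
  have hexp : (g' + 2) * (T.card + 2) = g' * T.card + 2 * g' + 2 * T.card + 4 := by ring
  omega

end Main

theorem IsKConnected.isCummerbundCovered {V : Type*} [Fintype V] {G : SimpleGraph V}
    [DecidableRel G.Adj] (hG : G.IsKConnected 2)
    (hd : (Fintype.card V : ℚ) / 3 ≤ (G.minDegree : ℚ)) : G.IsCummerbundCovered := by
  classical
  intro v
  rw [exists_isCummerbund_iff]
  obtain ⟨U₀, hU₀⟩ := hG.exists_cycleOn
  obtain ⟨U, hU, hmax⟩ := (Finset.univ.filter (CycleOn G)).exists_max_image Finset.card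
    ⟨U₀, by simpa using hU₀⟩
  refine hG.exists_longest_cycleOn_mem (d := G.minDegree) (fun x => G.minDegree_le_degree x) ?_
    (by simpa using hU) (fun U' h => hmax U' (by simpa using h)) v
  have : (Fintype.card V : ℚ) ≤ 3 * G.minDegree := by linarith
  exact_mod_cast this

end SimpleGraph

/-! ### Sharpness. -/

namespace SimpleGraph

/-- The join of the complete graph on the colour class `0` with the disjoint union of the complete
graphs on the other colour classes. -/
def hubGraph {V : Type*} (κ : V → ℕ) : SimpleGraph V where
  Adj u v := u ≠ v ∧ (κ u = 0 ∨ κ v = 0 ∨ κ u = κ v)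
  symm := ⟨fun u v h => ⟨h.1.symm, by rcases h.2 with h | h | h <;> simp [h]⟩⟩
  loopless := ⟨fun u h => h.1 rfl⟩

lemma hubGraph_adj {V : Type*} {κ : V → ℕ} {u v : V} :
    (hubGraph κ).Adj u v ↔ u ≠ v ∧ (κ u = 0 ∨ κ v = 0 ∨ κ u = κ v) :=
  Iff.rfl

section Hub

variable {V : Type*} {κ : V → ℕ}

/-- Different nonzero colours are never adjacent, so a path changes colour only at a hub vertex. -/
lemma PathOn.exists_hub [DecidableEq V] {p q : V} {T : Finset V} (h : PathOn (hubGraph κ) p q T)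
    (hpq : κ p ≠ κ q) : ∃ z ∈ T, κ z = 0 := by
  induction h with
  | single a => exact absurd rfl hpq
  | @cons a x b T hax ha h ih =>
    by_cases he : κ x = κ b
    · rcases hax.2 with h0 | h0 | h0
      · exact ⟨a, by simp, h0⟩
      · exact ⟨x, by simp [h.left_mem], h0⟩
      · exact absurd (h0.trans he) hpq
    · obtain ⟨z, hz, hz0⟩ := ih he
      exact ⟨z, by simp [hz], hz0⟩

variable [Fintype V]

lemma hubGraph_isKConnected (hκ : 2 ≤ (Finset.univ.filter fun v => κ v = 0).card)
    (hV : 2 < Fintype.card V) : (hubGraph κ).IsKConnected 2 := by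
  classical
  refine ⟨hV, fun S hS => ?_⟩
  obtain ⟨z, hz, hzS⟩ := Finset.exists_mem_notMem_of_card_lt_card (hS.trans_le hκ)
  have hz0 : κ z = 0 := by simpa using hz
  rw [connected_iff_exists_forall_reachable]
  refine ⟨⟨z, hzS⟩, fun ⟨w, hw⟩ => ?_⟩
  by_cases hzw : z = w
  · subst hzw
    exact Reachable.refl _
  · refine Adj.reachable ?_
    exact ⟨hzw, .inl hz0⟩

/-- A cycle meets at most two of the nonzero colour classes if the class `0` has two vertices. -/
lemma CycleOn.colour_eq [DecidableEq V] (hκ : (Finset.univ.filter fun v => κ v = 0).card ≤ 2)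
    {U : Finset V} (hU : CycleOn (hubGraph κ) U) {p q r : V} (hp : p ∈ U) (hq : q ∈ U) (hr : r ∈ U)
    (hp0 : κ p ≠ 0) (hq0 : κ q ≠ 0) (hr0 : κ r ≠ 0) (hpq : κ p ≠ κ q) (hpr : κ p ≠ κ r) :
    κ q = κ r := by
  by_contra hqr
  obtain ⟨T₁, T₂, h1, h2, rfl, h12⟩ := hU.exists_paths hp hq fun h => hpq (h ▸ rfl)
  -- If `r` were on one arc, the stretches from `p` to `r`, from `r` to `q` and along the other arc
  -- would need three distinct hub vertices.
  have key : ∀ T₁ T₂, PathOn (hubGraph κ) p q T₁ → PathOn (hubGraph κ) p q T₂ →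
      (∀ z ∈ T₁, z ∈ T₂ → z = p ∨ z = q) → r ∉ T₁ := by
    intro T₁ T₂ h1 h2 h12 hr
    obtain ⟨T₃, T₄, h3, h4, rfl, h34⟩ := h1.split hr
    obtain ⟨x, hx, hx0⟩ := h3.exists_hub hpr
    obtain ⟨y, hy, hy0⟩ := h4.exists_hub fun h => hqr h.symm
    obtain ⟨z, hz, hz0⟩ := h2.exists_hub hpq
    have hxy : x ≠ y := by
      rintro rfl
      exact hr0 (h34 x hx hy ▸ hx0)
    have hne : ∀ x ∈ T₃ ∪ T₄, κ x = 0 → x ≠ z := by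
      rintro x hx hx0 rfl
      rcases h12 x hx hz with rfl | rfl
      · exact hp0 hx0
      · exact hq0 hx0
    have : 2 < (Finset.univ.filter fun v => κ v = 0).card :=
      Finset.two_lt_card.2 ⟨x, by simp [hx0], y, by simp [hy0], z, by simp [hz0], hxy,
        hne x (by simp [hx]) hx0, hne y (by simp [hy]) hy0⟩
    omega
  rcases Finset.mem_union.1 hr with hr | hr
  · exact key T₁ T₂ h1 h2 h12 hr
  · exact key T₂ T₁ h2 h1 (fun z hz hz' => h12 z hz' hz) hr

/-- Two colour classes can be joined to a cycle through two vertices of colour `0`. -/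
lemma hubGraph_cycleOn [DecidableEq V] {i j : ℕ} (hij : i ≠ j) {x y : V} (hxy : x ≠ y)
    (hx : κ x = 0) (hy : κ y = 0) (hi : ∃ z, κ z = i ∧ i ≠ 0) :
    CycleOn (hubGraph κ) (insert x (insert y (Finset.univ.filter fun v => κ v = i)) ∪
      insert x (insert y (Finset.univ.filter fun v => κ v = j))) := by
  have hcl : ∀ i, ∀ a ∈ insert x (insert y (Finset.univ.filter fun v => κ v = i)),
      ∀ b ∈ insert x (insert y (Finset.univ.filter fun v => κ v = i)), a ≠ b →
        (hubGraph κ).Adj a b := by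
    intro i a ha b hb hab
    refine ⟨hab, ?_⟩
    simp only [Finset.mem_insert, Finset.mem_filter_univ] at ha hb
    grind
  have h1 := PathOn.exists_of_clique (hcl i) (a := x) (b := y) (by simp) (by simp) hxy
  have h2 := PathOn.exists_of_clique (hcl j) (a := y) (b := x) (by simp) (by simp) hxy.symm
  refine h1.cycleOn_union h2 hxy ?_ ?_
  · intro z hz hz'
    simp only [Finset.mem_insert, Finset.mem_filter_univ] at hz hz'
    grind
  · obtain ⟨z, hz, hi0⟩ := hi
    refine Finset.two_lt_card.2 ⟨x, by simp, y, by simp, z, by simp [hz], hxy, ?_, ?_⟩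
    · rintro rfl
      omega
    · rintro rfl
      omega

lemma hubGraph_degree [DecidableRel (hubGraph κ).Adj] {u : V} (hu : κ u ≠ 0) :
    (hubGraph κ).degree u + 1 = (Finset.univ.filter fun v => κ v = κ u).card +
      (Finset.univ.filter fun v => κ v = 0).card := by
  classical
  rw [← card_neighborFinset_eq_degree, ← Finset.card_union_of_disjoint,
    ← Finset.card_insert_of_notMem (a := u) (by simp)]
  · congr 1
    ext v
    simp only [Finset.mem_insert, mem_neighborFinset, hubGraph_adj, Finset.mem_union,
      Finset.mem_filter_univ]
    grind
  · rw [Finset.disjoint_left]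
    intro v hv hv'
    rw [Finset.mem_filter_univ] at hv hv'
    exact hu (hv.symm.trans hv')

lemma hubGraph_degree_hub [DecidableRel (hubGraph κ).Adj] {u : V} (hu : κ u = 0) :
    (hubGraph κ).degree u + 1 = Fintype.card V := by
  classical
  rw [← card_neighborFinset_eq_degree, ← Finset.card_insert_of_notMem (a := u) (by simp),
    ← Finset.card_univ]
  congr 1
  ext v
  simp only [Finset.mem_insert, mem_neighborFinset, hubGraph_adj, Finset.mem_univ, iff_true]
  grind

/-- The vertices of a smallest class among three nonzero colour classes lie on no longest cycle,
if the class `0` has two vertices. -/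
lemma hubGraph_not_isCummerbundCovered
    (hκ : (Finset.univ.filter fun v => κ v = 0).card = 2) (hκ3 : ∀ v, κ v ≤ 3)
    {p : V} (hp : κ p = 1)
    (h2 : (Finset.univ.filter fun v => κ v = 1).card < (Finset.univ.filter fun v => κ v = 2).card)
    (h3 : (Finset.univ.filter fun v => κ v = 1).card < (Finset.univ.filter fun v => κ v = 3).card) :
    ¬ (hubGraph κ).IsCummerbundCovered := by
  classical
  intro hcov
  obtain ⟨U, hU, hmax, hpU⟩ := (exists_isCummerbund_iff p).1 (hcov p)
  obtain ⟨x, y, hxy, hxy'⟩ := Finset.card_eq_two.1 hκ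
  have hx : κ x = 0 := by
    have : x ∈ Finset.univ.filter fun v => κ v = 0 := by simp [hxy']
    simpa using this
  have hy : κ y = 0 := by
    have : y ∈ Finset.univ.filter fun v => κ v = 0 := by simp [hxy']
    simpa using this
  obtain ⟨z, hz⟩ := Finset.card_pos.1 ((Nat.zero_le _).trans_lt h2)
  have hbig := hmax _ (hubGraph_cycleOn (i := 2) (j := 3) (by omega) hxy hx hy
    ⟨z, by simpa using hz, by omega⟩)
  -- The cycle through classes 2 and 3 misses only class 1, whereas a cycle meeting class 1 misses
  -- class 2 or 3, which is larger.
  have hbig' : Fintype.card V ≤ U.card + (Finset.univ.filter fun v => κ v = 1).card := by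
    refine le_trans ?_ (Nat.add_le_add_right hbig _)
    rw [← Finset.card_univ]
    refine le_trans (Finset.card_le_card fun v _ => ?_) (Finset.card_union_le _ _)
    have h0 : κ v = 0 → v = x ∨ v = y := fun h => by
      have : v ∈ Finset.univ.filter fun v => κ v = 0 := by simp [h]
      rw [hxy'] at this
      simpa using this
    have := hκ3 v
    simp only [Finset.mem_union, Finset.mem_insert, Finset.mem_filter_univ]
    have : κ v = 0 ∨ κ v = 1 ∨ κ v = 2 ∨ κ v = 3 := by omega
    tauto
  have hsmall : ∀ i, (∀ q ∈ U, κ q ≠ i) →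
      U.card + (Finset.univ.filter fun v => κ v = i).card ≤ Fintype.card V := by
    intro i hi
    rw [← Finset.card_union_of_disjoint]
    · exact Finset.card_le_univ _
    · rw [Finset.disjoint_left]
      intro q hq hq'
      exact hi q hq (by simpa using hq')
  by_cases hq : ∃ q ∈ U, κ q = 2
  · obtain ⟨q, hqU, hq⟩ := hq
    have := hsmall 3 (fun r hr hr3 => by
      have := hU.colour_eq hκ.le hpU hqU hr (by omega) (by omega) (by omega) (by omega) (by omega)
      omega)
    omega
  · push Not at hq
    have := hsmall 2 hq
    omega

end Hub

lemma Fin.card_filter_Ico_val {n lo hi : ℕ} (hhi : hi ≤ n) (P : Fin n → Prop) [DecidablePred P]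
    (hP : ∀ v : Fin n, P v ↔ lo ≤ v.val ∧ v.val < hi) :
    (Finset.univ.filter P).card = hi - lo := by
  rw [← Nat.card_Ico, ← Finset.card_image_of_injective _ Fin.val_injective]
  congr 1
  ext i
  simp only [Finset.mem_image, Finset.mem_filter_univ, hP, Finset.mem_Ico]
  constructor
  · rintro ⟨v, hv, rfl⟩
    exact hv
  · intro hi'
    exact ⟨⟨i, by omega⟩, hi', rfl⟩

lemma exists_not_isCummerbundCovered (n : ℕ) (hn : 9 ≤ n) :
    ∃ (G : SimpleGraph (Fin n)) (_ : DecidableRel G.Adj),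
      G.IsKConnected 2 ∧ (G.minDegree : ℤ) = ⌈(n : ℚ) / 3⌉ - 1 ∧ ¬ G.IsCummerbundCovered := by
  classical
  obtain ⟨a, b, c, ha, hab, hac, hsum, hlo, hhi⟩ : ∃ a b c : ℕ, 0 < a ∧ a < b ∧ a < c ∧
      n = 2 + a + b + c ∧ 3 * a + 3 < n ∧ n ≤ 3 * a + 6 := by
    -- Here `(n + 2) / 3` is ⌈n/3⌉. A vertex of the smallest clique has degree `a + 1`, so `a` is
    -- ⌈n/3⌉ - 2, and the other two cliques share the rest evenly.
    refine ⟨(n + 2) / 3 - 2, (n - (n + 2) / 3) / 2, n - (n + 2) / 3 - (n - (n + 2) / 3) / 2, ?_⟩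
    omega
  let κ : Fin n → ℕ := fun v =>
    if v.val < 2 then 0 else if v.val < 2 + a then 1 else if v.val < 2 + a + b then 2 else 3
  have hκ : ∀ v : Fin n, κ v =
    if v.val < 2 then 0 else if v.val < 2 + a then 1 else if v.val < 2 + a + b then 2 else 3 :=
    fun _ => rfl
  have c0 : (Finset.univ.filter fun v => κ v = 0).card = 2 :=
    Fin.card_filter_Ico_val (lo := 0) (hi := 2) (by omega) _ (by intro v; grind)
  have c1 : (Finset.univ.filter fun v => κ v = 1).card = a := by
    rw [Fin.card_filter_Ico_val (lo := 2) (hi := 2 + a) (by omega) _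
      (by intro v; grind)]
    omega
  have c2 : (Finset.univ.filter fun v => κ v = 2).card = b := by
    rw [Fin.card_filter_Ico_val (lo := 2 + a) (hi := 2 + a + b) (by omega) _
      (by intro v; grind)]
    omega
  have c3 : (Finset.univ.filter fun v => κ v = 3).card = c := by
    rw [Fin.card_filter_Ico_val (lo := 2 + a + b) (hi := n) (by omega) _
      (by intro v; have := v.2; grind)]
    omega
  have hκ3 : ∀ v, κ v ≤ 3 := by intro v; rw [hκ]; split_ifs <;> omega
  have hp : κ ⟨2, by omega⟩ = 1 := by
    rw [hκ, if_neg (by simp), if_pos (by simpa using ha)]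
  refine ⟨hubGraph κ, inferInstance, hubGraph_isKConnected (by omega) (by simp; omega), ?_,
    hubGraph_not_isCummerbundCovered c0 hκ3 hp (by omega) (by omega)⟩
  have hmin : (hubGraph κ).minDegree = a + 1 := by
    have : Nonempty (Fin n) := ⟨⟨2, by omega⟩⟩
    refine le_antisymm ?_ (le_minDegree_of_forall_le_degree _ _ fun v => ?_)
    · refine ((hubGraph κ).minDegree_le_degree ⟨2, by omega⟩).trans ?_
      have := hubGraph_degree (κ := κ) (u := ⟨2, by omega⟩) (by omega)
      rw [hp] at this
      omega
    · have h3 := hκ3 v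
      by_cases h0 : κ v = 0
      · have := hubGraph_degree_hub h0
        rw [Fintype.card_fin] at this
        omega
      · have := hubGraph_degree h0
        obtain h | h | h : κ v = 1 ∨ κ v = 2 ∨ κ v = 3 := by omega
        all_goals
          rw [h] at this
          omega
  have hceil : ⌈(n : ℚ) / 3⌉ = (a : ℤ) + 2 := by
    rw [Int.ceil_eq_iff]
    have h1 : (3 * a + 3 : ℚ) < n := by exact_mod_cast hlo
    have h2 : (n : ℚ) ≤ 3 * a + 6 := by exact_mod_cast hhi
    push_cast
    constructor <;> linarith
  rw [hmin, hceil]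
  push_cast
  ring

end SimpleGraph

theorem theorem3 :
    (∀ (V : Type*) [Fintype V] (G : SimpleGraph V) [DecidableRel G.Adj],
      G.IsKConnected 2 → (Fintype.card V : ℚ) / 3 ≤ (G.minDegree : ℚ) →
        G.IsCummerbundCovered) ∧
    (∀ n : ℕ, 9 ≤ n →
      ∃ (G : SimpleGraph (Fin n)) (_ : DecidableRel G.Adj),
        G.IsKConnected 2 ∧ (G.minDegree : ℤ) = ⌈(n : ℚ) / 3⌉ - 1 ∧
          ¬ G.IsCummerbundCovered) := by
  exact ⟨fun V _ G _ hG hd => hG.isCummerbundCovered hd,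
    SimpleGraph.exists_not_isCummerbundCovered⟩
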